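/- Scales and moduli. Let $\mathcal Z=\{\ldots,\tfrac13,\tfrac12,1,2,3,\ldots\}$, and let $\mathcal N$ be the set of non-decreasing functions $\mathcal Z\to[0,\infty]$. For a real number $t>0$ let $t_-$ and $t_+$ be the largest and the smallest element of $\mathcal Z$, respectively, with $t_-\le t\le t_+$. For a map $\phi\colon X\to E$ between metric spaces and $r\in\mathcal Z$ put $$\kappa_\phi(r)=\inf\{d(\phi(x),\phi(y)) : d(x,y)\ge r\},\qquad \omega_\phi(r)=\sup\{d(\phi(x),\phi(y)) : d(x,y)\le r\},$$ where $\inf\emptyset=\infty$. Let - $\mathcal M_{\mathrm{coarse}}$ be the set of $(\kappa,\omega)\in\mathcal N\times\mathcal N$ with $\omega(r)<\infty$ for all $r\in\mathcal Z$ and $\lim_{n\to\infty}\kappa(n)=\infty$; - $\mathcal M_{\mathrm{uniform}}$ be the set of $(\kappa,\omega)\in\mathcal N\times\mathcal N$ with $\kappa(r)>0$ for all $r\in\mathcal Z$ and $\lim_{n\to\infty}\omega(\tfrac1n)=0$; - $\mathcal M_{\mathrm{Lipschitz}}$ be the set of $(\kappa,\omega)\in\mathcal N\times\mathcal N$ for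 which there are $0<c<C<\infty$ with $\kappa(r)\ge cr$ and $\omega(r)\le Cr$ for all $r\in\mathcal Z$. The map $\phi$ is a coarse, uniform or bi-Lipschitz embedding if $(\kappa_\phi,\omega_\phi)$ belongs to $\mathcal M_{\mathrm{coarse}}$, $\mathcal M_{\mathrm{uniform}}$ or $\mathcal M_{\mathrm{Lipschitz}}$, respectively, and $X$ coarsely, uniformly or bi-Lipschitz embeds into $E$ if such a $\phi$ exists. The relation $<$. Let $D=\{x_1,x_2,\ldots\}$ be an enumerated dense subset of $X$ (repetitions allowed). Let $\Omega(D,E)$ be the set of quadruples $(\kappa,\omega,k,\phi)$ with $\kappa,\omega\in\mathcal N$, $k\in\{1,2,3,\ldots\}$ and $\phi\colon D\to E$ such that $$\kappa(d(x,y)_-)\le d(\phi(x),\phi(y))\le\omega(d(x,y)_+)\quad\text{for all distinct }x,y\in\{x_1,\ldots,x_k\}.$$ Let $\mathcal{C}oa(D,E)$, $\mathcal{U}ni(D,E)$ and $\mathcal{L}ip(D,E)$ be the sets of those $(\kappa,\omega,k,\phi)\in\Omega(D,E)$ for which $(\kappa,\omega)$ lies in $\mathcal M_{\mathrm{coarse}}$,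 $\mathcal M_{\mathrm{uniform}}$ and $\mathcal M_{\mathrm{Lipschitz}}$, respectively. Put $(\kappa,\omega,k,\phi)<(\kappa',\omega',k',\phi')$ if $(\kappa,\omega)=(\kappa',\omega')$, $k=k'+1$, and $\phi$ and $\phi'$ agree on $\{x_1,\ldots,x_{k'}\}$. Rank. If $\prec$ is a well-founded relation on a set $A$, let $\rho(a)=\sup\{\rho(b)+1 : b\prec a\}$ for $a\in A$; the rank of $(A,\prec)$ is the ordinal $\mathrm{rk}(A,\prec)=\sup\{\rho(a)+1 : a\in A\}$. Theorem. Let $X$ and $E$ be separable complete metric spaces and let $D=\{x_1,x_2,\ldots\}$ be a fixed enumeration of a dense subset of $X$. Then: 1. either $X$ coarsely embeds into $E$, or $<$ is well-founded on $\mathcal{C}oa(D,E)$ and $\mathrm{rk}(\mathcal{C}oa(D,E),<)$ is a countable ordinal; 2. either $X$ uniformly embeds into $E$, or $<$ is well-founded on $\mathcal{U}ni(D,E)$ and $\mathrm{rk}(\mathcal{U}ni(D,E),<)$ is a countable ordinal; 3. either $X$ bi-Lipschitz embeds into $E$, or $<$ is well-founded on $\mathcal{L}ip(D,E)$ and $\mathrm{rk}(\mathcal{L}ip(D,E),<)$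 is a countable ordinal. -/

import Mathlib

open Filter Topology TopologicalSpace
open scoped ENNReal Cardinal

noncomputable section

universe u

namespace EmbRank

/-- The set `{…, 1/3, 1/2, 1, 2, 3, …}` of scales. -/
def Scale : Set ℝ := {r | ∃ n : ℕ+, r = (n : ℝ) ∨ r = ((n : ℝ))⁻¹}

/-- The scale `n`. -/
def Scale.nat (n : ℕ+) : Scale := ⟨(n : ℝ), n, Or.inl rfl⟩

/-- The scale `1 / n`. -/
def Scale.inv (n : ℕ+) : Scale := ⟨((n : ℝ))⁻¹, n, Or.inr rfl⟩

theorem exists_isGreatest_scale_le {t : ℝ} (ht : 0 < t) :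
    ∃ r : Scale, IsGreatest {s : Scale | (s : ℝ) ≤ t} r := by
  rcases le_or_gt 1 t with h1 | h1
  · have hp : 0 < ⌊t⌋₊ := Nat.floor_pos.2 h1
    refine ⟨Scale.nat ⟨⌊t⌋₊, hp⟩, Nat.floor_le ht.le, ?_⟩
    rintro ⟨s, n, rfl | rfl⟩ hs
    · have hs' : (n : ℝ) ≤ t := hs
      have h2 : (n : ℕ) ≤ ⌊t⌋₊ := Nat.le_floor hs'
      exact (Nat.cast_le (α := ℝ)).2 h2
    · have h2 : ((n : ℝ))⁻¹ ≤ 1 := inv_le_one_of_one_le₀ (by exact_mod_cast n.pos)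
      exact h2.trans (by exact_mod_cast hp : (1 : ℝ) ≤ (⌊t⌋₊ : ℝ))
  · have hp : 0 < ⌈t⁻¹⌉₊ := Nat.ceil_pos.2 (inv_pos.2 ht)
    refine ⟨Scale.inv ⟨⌈t⁻¹⌉₊, hp⟩, ?_, ?_⟩
    · exact inv_le_of_inv_le₀ ht (Nat.le_ceil _)
    · rintro ⟨s, n, rfl | rfl⟩ hs
      · have h2 : (1 : ℝ) ≤ (n : ℝ) := by exact_mod_cast n.pos
        exact absurd (h2.trans hs) (not_le.2 h1)
      · have hn : (0 : ℝ) < (n : ℝ) := by exact_mod_cast n.pos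
        have h2 : ⌈t⁻¹⌉₊ ≤ (n : ℕ) := Nat.ceil_le.2 (inv_le_of_inv_le₀ hn hs)
        have hp' : (0 : ℝ) < (⌈t⁻¹⌉₊ : ℝ) := by exact_mod_cast hp
        have h3 : (⌈t⁻¹⌉₊ : ℝ) ≤ (n : ℝ) := by exact_mod_cast h2
        exact inv_anti₀ hp' h3

theorem exists_isLeast_le_scale {t : ℝ} (ht : 0 < t) :
    ∃ r : Scale, IsLeast {s : Scale | t ≤ (s : ℝ)} r := by
  rcases le_or_gt 1 t with h1 | h1
  · have hp : 0 < ⌈t⌉₊ := Nat.ceil_pos.2 ht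
    refine ⟨Scale.nat ⟨⌈t⌉₊, hp⟩, Nat.le_ceil t, ?_⟩
    rintro ⟨s, n, rfl | rfl⟩ hs
    · have hs' : t ≤ (n : ℝ) := hs
      have h2 : ⌈t⌉₊ ≤ (n : ℕ) := Nat.ceil_le.2 hs'
      exact (Nat.cast_le (α := ℝ)).2 h2
    · have h2 : ((n : ℝ))⁻¹ ≤ 1 := inv_le_one_of_one_le₀ (by exact_mod_cast n.pos)
      have hs' : t ≤ ((n : ℝ))⁻¹ := hs
      have h3 : ⌈t⌉₊ ≤ 1 := Nat.ceil_le.2 (by push_cast; linarith)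
      have h4 : (⌈t⌉₊ : ℝ) ≤ 1 := by exact_mod_cast h3
      exact h4.trans (h1.trans hs')
  · have hp : 0 < ⌊t⁻¹⌋₊ := Nat.floor_pos.2 ((one_le_inv₀ ht).2 h1.le)
    have hp' : (0 : ℝ) < (⌊t⁻¹⌋₊ : ℝ) := by exact_mod_cast hp
    refine ⟨Scale.inv ⟨⌊t⁻¹⌋₊, hp⟩, ?_, ?_⟩
    · exact le_inv_of_le_inv₀ hp' (Nat.floor_le (inv_pos.2 ht).le)
    · rintro ⟨s, n, rfl | rfl⟩ hs
      · have h2 : (1 : ℝ) ≤ (n : ℝ) := by exact_mod_cast n.pos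
        have h3 : ((⌊t⁻¹⌋₊ : ℝ))⁻¹ ≤ 1 := inv_le_one_of_one_le₀ (by exact_mod_cast hp)
        exact h3.trans h2
      · have hn : (0 : ℝ) < (n : ℝ) := by exact_mod_cast n.pos
        have h2 : (n : ℕ) ≤ ⌊t⁻¹⌋₊ := Nat.le_floor (le_inv_of_le_inv₀ ht hs)
        have h3 : (n : ℝ) ≤ (⌊t⁻¹⌋₊ : ℝ) := by exact_mod_cast h2
        exact inv_anti₀ hn h3

/-- `t₋`, the largest scale below `t > 0`. -/
def lower (t : ℝ) (ht : 0 < t) : Scale := (exists_isGreatest_scale_le ht).choose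

/-- `t₊`, the smallest scale above `t > 0`. -/
def upper (t : ℝ) (ht : 0 < t) : Scale := (exists_isLeast_le_scale ht).choose

theorem lower_spec (t : ℝ) (ht : 0 < t) :
    IsGreatest {s : Scale | (s : ℝ) ≤ t} (lower t ht) :=
  (exists_isGreatest_scale_le ht).choose_spec

theorem upper_spec (t : ℝ) (ht : 0 < t) :
    IsLeast {s : Scale | t ≤ (s : ℝ)} (upper t ht) :=
  (exists_isLeast_le_scale ht).choose_spec

/-- The set of non-decreasing functions from the scales to `[0, ∞]`. -/
def Moduli : Set (Scale → ℝ≥0∞) := {κ | Monotone κ}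

section Embeddings

variable {X : Type*} {E : Type*} [MetricSpace X] [MetricSpace E]

/-- The compression modulus of a map. -/
def compression (φ : X → E) : Moduli :=
  ⟨fun r => sInf {t | ∃ x y : X, (r : ℝ) ≤ dist x y ∧ t = edist (φ x) (φ y)}, by
    intro r s hrs
    refine sInf_le_sInf ?_
    rintro t ⟨x, y, h, rfl⟩
    exact ⟨x, y, (show (r : ℝ) ≤ s from hrs).trans h, rfl⟩⟩

/-- The expansion modulus of a map. -/
def expansion (φ : X → E) : Moduli :=
  ⟨fun r => sSup {t | ∃ x y : X, dist x y ≤ (r : ℝ) ∧ t = edist (φ x) (φ y)}, by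
    intro r s hrs
    refine sSup_le_sSup ?_
    rintro t ⟨x, y, h, rfl⟩
    exact ⟨x, y, h.trans (show (r : ℝ) ≤ s from hrs), rfl⟩⟩

end Embeddings

/-- Pairs `(κ, ω)` with `ω` finite everywhere and `κ(n) → ∞`. -/
def MCoarse : Set (Moduli × Moduli) :=
  {p | (∀ r : Scale, p.2.1 r < ∞) ∧ Tendsto (fun n : ℕ+ => p.1.1 (Scale.nat n)) atTop (𝓝 ∞)}

/-- Pairs `(κ, ω)` with `κ` positive everywhere and `ω(1/n) → 0`. -/
def MUniform : Set (Moduli × Moduli) :=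
  {p | (∀ r : Scale, 0 < p.1.1 r) ∧ Tendsto (fun n : ℕ+ => p.2.1 (Scale.inv n)) atTop (𝓝 0)}

/-- Pairs `(κ, ω)` with `κ(r) ≥ c r` and `ω(r) ≤ C r` for some `0 < c < C < ∞`. -/
def MLipschitz : Set (Moduli × Moduli) :=
  {p | ∃ c C : ℝ, 0 < c ∧ c < C ∧
    ∀ r : Scale, ENNReal.ofReal (c * r) ≤ p.1.1 r ∧ p.2.1 r ≤ ENNReal.ofReal (C * r)}

/-- There is a map `X → E` whose pair of moduli belongs to the class `M`. -/
def Embeds (M : Set (Moduli × Moduli)) (X E : Type*) [MetricSpace X] [MetricSpace E] : Prop :=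
  ∃ φ : X → E, (compression φ, expansion φ) ∈ M

/-- `X` coarsely embeds into `E`. -/
def CoarselyEmbeds (X E : Type*) [MetricSpace X] [MetricSpace E] : Prop := Embeds MCoarse X E

/-- `X` uniformly embeds into `E`. -/
def UniformlyEmbeds (X E : Type*) [MetricSpace X] [MetricSpace E] : Prop := Embeds MUniform X E

/-- `X` bi-Lipschitz embeds into `E`. -/
def BiLipschitzEmbeds (X E : Type*) [MetricSpace X] [MetricSpace E] : Prop :=
  Embeds MLipschitz X E

section Ranks

variable {X : Type*} [MetricSpace X]

/-- Quadruples `(κ, ω, k, φ)`, where `φ : D → E` and `D = {x₁, x₂, …}` is the range of `x`. -/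
abbrev Quad (x : ℕ+ → X) (E : Type*) : Type _ :=
  Moduli × Moduli × ℕ+ × (Set.range x → E)

/-- The space `Ω(D, E)`. -/
def Omega (x : ℕ+ → X) (E : Type*) [MetricSpace E] : Set (Quad x E) :=
  {q | match q with
    | (κ, ω, k, φ) => ∀ a b : Set.range x, a.1 ∈ x '' Set.Iic k → b.1 ∈ x '' Set.Iic k →
        ∀ h : a.1 ≠ b.1,
          κ.1 (lower (dist a.1 b.1) (dist_pos.2 h)) ≤ edist (φ a) (φ b) ∧
          edist (φ a) (φ b) ≤ ω.1 (upper (dist a.1 b.1) (dist_pos.2 h))}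

/-- The part of `Ω(D, E)` whose moduli `(κ, ω)` lie in the class `M`. -/
def OmegaIn (M : Set (Moduli × Moduli)) (x : ℕ+ → X) (E : Type*) [MetricSpace E] :
    Set (Quad x E) :=
  {q | q ∈ Omega x E ∧ (q.1, q.2.1) ∈ M}

/-- `Coa(D, E)`. -/
def Coa (x : ℕ+ → X) (E : Type*) [MetricSpace E] : Set (Quad x E) := OmegaIn MCoarse x E

/-- `Uni(D, E)`. -/
def Uni (x : ℕ+ → X) (E : Type*) [MetricSpace E] : Set (Quad x E) := OmegaIn MUniform x E

/-- `Lip(D, E)`. -/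
def Lip (x : ℕ+ → X) (E : Type*) [MetricSpace E] : Set (Quad x E) := OmegaIn MLipschitz x E

/-- The relation `(κ, ω, k, φ) < (κ', ω', k', φ')`: the moduli agree, `k = k' + 1`, and
`φ`, `φ'` agree on `{x₁, …, x_{k'}}`. -/
def Below {x : ℕ+ → X} {E : Type*} : Quad x E → Quad x E → Prop
  | (κ, ω, k, φ), (κ', ω', k', φ') =>
      (κ, ω) = (κ', ω') ∧ k = k' + 1 ∧
        ∀ a : Set.range x, a.1 ∈ x '' Set.Iic k' → φ a = φ' a

/-- `Below` restricted to a set of quadruples. -/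
def BelowOn {x : ℕ+ → X} {E : Type*} (A : Set (Quad x E)) : A → A → Prop :=
  fun p q => Below p.1 q.1

end Ranks

/-- The rank `sup {ρ(a) + 1 | a ∈ A}` of a well-founded relation on `A`, where `ρ` is its
ordinal-valued rank function `ρ(a) = sup {ρ(b) + 1 | b ≺ a}`. -/
def rk {A : Type u} {r : A → A → Prop} (h : WellFounded r) : Ordinal.{u} :=
  ⨆ a : A, Order.succ (h.apply a).rank

/-- The relation is well-founded (so that its rank is defined) and its rank is a countable
ordinal. -/
def HasCountableRank {A : Type*} (r : A → A → Prop) : Prop :=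
  ∃ h : WellFounded r, (rk h).card ≤ ℵ₀

end EmbRank

end

/-! An infinite descending chain for `<` fixes one pair of moduli, while `k` grows and the partial
maps agree on longer and longer initial parts of `D`. They therefore glue to a single map on all of
`D` controlled by these moduli (`exists_isControlled_of_not_wellFounded`), and such a map yields an
embedding of `X` of the same type: by rounding to points of `D` in the coarse case, by extension to
the closure in the other two.

If there is no such chain, `<` is well-founded. The quadruples form a Polish space, in which the
relation is closed and the three classes of moduli are Borel. The graph of `<` is then Borel, hence
analytic, and the Kunen–Martin theorem (`hasCountableRank_of_analyticSet`) bounds the rank. -/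

namespace EmbRank

/-! ### The Kunen–Martin theorem. -/

section KunenMartin

/-- The first `n` entries of the first `n` members of a sequence in the Baire space. -/
def truncation (z : ℕ → ℕ → ℕ) (n : ℕ) : List (List ℕ) :=
  (List.range n).map fun i => (List.range n).map (z i)

theorem truncation_eq_iff {y z : ℕ → ℕ → ℕ} {m n : ℕ} :
    truncation y m = truncation z n ↔ m = n ∧ ∀ i < n, ∀ j < n, y i j = z i j := by
  constructor
  · intro h
    have hmn : m = n := by simpa [truncation] using congrArg List.length h
    subst hmn
    refine ⟨rfl, fun i hi j hj => ?_⟩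
    have h1 := List.map_inj_left.1 h i (List.mem_range.2 hi)
    exact List.map_inj_left.1 h1 j (List.mem_range.2 hj)
  · rintro ⟨rfl, h⟩
    refine List.map_inj_left.2 fun i hi => List.map_inj_left.2 fun j hj => ?_
    exact h i (List.mem_range.1 hi) j (List.mem_range.1 hj)

variable {P : Type*}

/-- The points `z 0, …, z (n - 1)` code, through `f`, consecutive pairs of a descending chain. -/
def CodesChain (f : (ℕ → ℕ) → P × P) (z : ℕ → ℕ → ℕ) (n : ℕ) : Prop :=
  ∀ i, i + 1 < n → (f (z i)).1 = (f (z (i + 1))).2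

/-- Extension by one step between truncations of coded chains. -/
def TruncationExtends (f : (ℕ → ℕ) → P × P) (v w : List (List ℕ)) : Prop :=
  ∃ z n, CodesChain f z (n + 1) ∧ v = truncation z (n + 1) ∧ w = truncation z n

/-- An infinite branch of truncations determines a sequence of codes in the Baire space. By
continuity of `f` and the Hausdorff property, these limit codes still describe consecutive pairs,
and so give an infinite descending chain in `P`. -/
theorem wellFounded_truncationExtends [TopologicalSpace P] [T2Space P] {f : (ℕ → ℕ) → P × P}
    (hf : Continuous f) (hchain : ¬ ∃ a : ℕ → P, ∀ n, (a (n + 1), a n) ∈ Set.range f) :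
    WellFounded (TruncationExtends f) := by
  rw [wellFounded_iff_isEmpty_descending_chain]
  refine ⟨fun ⟨w, hw⟩ => hchain ?_⟩
  choose z n hc hv hw using hw
  have hstep : ∀ k, n (k + 1) = n k + 1 ∧
      ∀ i < n k + 1, ∀ j < n k + 1, z (k + 1) i j = z k i j := fun k =>
    truncation_eq_iff.1 ((hw (k + 1)).symm.trans (hv k))
  have hn : ∀ k, k ≤ n k := by
    intro k
    induction k with
    | zero => exact Nat.zero_le _
    | succ k ih => have := (hstep k).1; omega
  -- Since `k ≤ n k`, the entry `(i, j)` of `z k` no longer changes once `k ≥ max i j`.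
  set y : ℕ → ℕ → ℕ := fun i j => z (max i j) i j with hy
  have hstab : ∀ i j k, max i j ≤ k → z k i j = y i j := by
    intro i j k hk
    induction k, hk using Nat.le_induction with
    | base => rfl
    | succ k hk ih =>
      have := hn k
      rw [(hstep k).2 i (by omega) j (by omega), ih]
  have hlim : ∀ i, Tendsto (fun k => z k i) atTop (𝓝 (y i)) := by
    intro i
    refine tendsto_pi_nhds.2 fun j => tendsto_const_nhds.congr' ?_
    filter_upwards [eventually_ge_atTop (max i j)] with k hk
    exact (hstab i j k hk).symm
  have heq : ∀ i, (f (y i)).1 = (f (y (i + 1))).2 := by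
    intro i
    have h1 := ((continuous_fst.comp hf).tendsto (y i)).comp (hlim i)
    have h2 := ((continuous_snd.comp hf).tendsto (y (i + 1))).comp (hlim (i + 1))
    refine tendsto_nhds_unique (h1.congr' ?_) h2
    filter_upwards [eventually_ge_atTop (i + 1)] with k hk
    have := hn k
    exact hc k i (by omega)
  refine ⟨fun i => (f (y i)).2, fun i => ⟨y i, Prod.ext (heq i) rfl⟩⟩

/-- Ranks leave no gaps: every ordinal below the rank of `w` is the rank of some element of the
countable set `W`. -/
theorem card_rank_le_aleph0 {W : Type u} [Countable W] {r : W → W → Prop} (hr : WellFounded r)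
    (w : W) : (hr.apply w).rank.card ≤ ℵ₀ := by
  rw [← Cardinal.lift_le.{u + 1}, Cardinal.lift_aleph0, ← Cardinal.mk_Iio_ordinal,
    Cardinal.mk_le_aleph0_iff]
  have hsub : Set.Iio (hr.apply w).rank ⊆ Set.range fun v : W => (hr.apply v).rank := by
    intro o ho
    obtain ⟨v, hv, rfl⟩ := Acc.mem_range_rank_of_le (hr.apply w) (le_of_lt ho)
    exact ⟨v, rfl⟩
  exact ((Set.countable_range _).mono hsub).to_subtype

/-- The Kunen–Martin theorem: a well-founded relation with an analytic graph has countable rank. -/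
theorem hasCountableRank_of_analyticSet [TopologicalSpace P] [T2Space P] {A : Set P}
    {r : A → A → Prop} (hr : WellFounded r)
    (hA : MeasureTheory.AnalyticSet {p : P × P | ∃ a b : A, r a b ∧ (a.1, b.1) = p}) :
    HasCountableRank r := by
  refine ⟨hr, ?_⟩
  -- The bound `o` comes from finite lists of natural numbers, which live in the lowest universe;
  -- hence the lift.
  suffices h : ∃ o : Ordinal.{0}, o.card ≤ ℵ₀ ∧ ∀ a, (hr.apply a).rank ≤ Ordinal.lift o by
    obtain ⟨o, ho, h⟩ := h
    have h1 : rk hr ≤ Order.succ (Ordinal.lift o) :=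
      Ordinal.iSup_le fun a => Order.succ_le_succ (h a)
    refine (Ordinal.card_le_card h1).trans ?_
    rw [Order.succ_eq_add_one, Ordinal.card_add_one, ← Ordinal.lift_card]
    exact Cardinal.add_le_aleph0.2 ⟨Cardinal.lift_le_aleph0.2 ho, Cardinal.one_le_aleph0⟩
  rw [MeasureTheory.AnalyticSet] at hA
  rcases hA with hA | ⟨f, hf, hrange⟩
  -- The graph is empty, so all ranks vanish.
  · refine ⟨0, by simp, fun a => ?_⟩
    rw [Acc.rank_eq]
    refine Ordinal.iSup_le fun b => ?_
    have : (b.1.1, a.1) ∈ (∅ : Set (P × P)) := hA ▸ ⟨b.1, a, b.2, rfl⟩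
    exact this.elim
  have hwf : WellFounded (TruncationExtends f) := by
    refine wellFounded_truncationExtends hf ?_
    rintro ⟨a, ha⟩
    have ha' : ∀ n, ∃ h : a n ∈ A, ∃ h' : a (n + 1) ∈ A, r ⟨_, h'⟩ ⟨_, h⟩ := by
      intro n
      have := ha n
      rw [hrange] at this
      obtain ⟨⟨b, hb⟩, ⟨c, hc⟩, hbc, h⟩ := this
      obtain ⟨rfl, rfl⟩ := Prod.mk.inj h
      exact ⟨hc, hb, hbc⟩
    exact (wellFounded_iff_isEmpty_descending_chain.1 hr).false
      ⟨fun n => ⟨a n, (ha' n).1⟩, fun n => (ha' n).2.2⟩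
  have hcode : ∀ {a b : A}, r b a → ∃ y, f y = (b.1, a.1) := by
    intro a b hba
    have : (b.1, a.1) ∈ Set.range f := hrange ▸ ⟨b, a, hba, rfl⟩
    exact this
  -- A step below `a` lengthens any coded chain ending at `a`, so it is matched by a step below its
  -- truncation. The case `n = 0` puts no condition on `a`: the rank of the empty truncation bounds
  -- all ranks at once.
  have key : ∀ a : A, ∀ z n, CodesChain f z n → (∀ m, n = m + 1 → (f (z m)).1 = a.1) →
      (hr.apply a).rank ≤ Ordinal.lift (hwf.apply (truncation z n)).rank := by
    intro a
    induction a using hr.induction with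
    | _ a ih =>
    intro z n hz hend
    rw [Acc.rank_eq]
    refine Ordinal.iSup_le fun ⟨b, hb⟩ => Order.succ_le_of_lt ?_
    obtain ⟨y, hy⟩ := hcode hb
    set z' := Function.update z n y with hz'
    have hz'n : z' n = y := Function.update_self ..
    have hz'lt : ∀ i, i < n → z' i = z i := fun i hi => Function.update_of_ne hi.ne _ _
    have hchain : CodesChain f z' (n + 1) := by
      intro i hi
      rw [hz'lt i (by omega)]
      rcases (show i + 1 < n ∨ n = i + 1 by omega) with h | h
      · rw [hz'lt _ h, hz i h]
      · rw [← h, hz'n, hy, hend i h]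
    have hle := ih b hb z' (n + 1) hchain (by
      rintro m hm
      obtain rfl : n = m := by omega
      rw [hz'n, hy])
    have htr : truncation z n = truncation z' n :=
      truncation_eq_iff.2 ⟨rfl, fun i hi j _ => by rw [hz'lt i hi]⟩
    refine hle.trans_lt (Ordinal.lift_lt.2 ?_)
    exact Acc.rank_lt_of_rel (hwf.apply _) ⟨z', n, hchain, rfl, htr⟩
  exact ⟨_, card_rank_le_aleph0 hwf (truncation (fun _ _ => 0) 0), fun a =>
    key a _ 0 (fun i hi => by omega) (fun m hm => by omega)⟩

end KunenMartin

/-! ### From controlled maps on a dense subset to embeddings. -/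

section Extension

variable {X E : Type*} [MetricSpace X] [MetricSpace E]

/-- The map `φ`, defined on a subset, is controlled by the moduli `κ` and `ω`. -/
def IsControlled {D : Set X} (κ ω : Scale → ℝ≥0∞) (φ : D → E) : Prop :=
  (∀ (r : Scale) (a b : D), (r : ℝ) ≤ dist a.1 b.1 → κ r ≤ edist (φ a) (φ b)) ∧
    ∀ (r : Scale) (a b : D), dist a.1 b.1 ≤ r → edist (φ a) (φ b) ≤ ω r

theorem Scale.pos (r : Scale) : 0 < (r : ℝ) := by
  obtain ⟨r, n, rfl | rfl⟩ := r
  · exact Nat.cast_pos.2 n.pos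
  · exact inv_pos.2 (Nat.cast_pos.2 n.pos)

theorem Scale.coe_nat (n : ℕ+) : (Scale.nat n : ℝ) = n := rfl

theorem Scale.coe_inv (n : ℕ+) : (Scale.inv n : ℝ) = (n : ℝ)⁻¹ := rfl

theorem Scale.exists_between {t : ℝ} (ht : 0 < t) : ∃ s : Scale, t ≤ s ∧ (s : ℝ) ≤ 2 * t := by
  rcases le_or_gt 1 t with h1 | h1
  · refine ⟨Scale.nat ⟨⌈t⌉₊, Nat.ceil_pos.2 ht⟩, Nat.le_ceil t, ?_⟩
    have := Nat.ceil_lt_add_one ht.le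
    change (⌈t⌉₊ : ℝ) ≤ _
    linarith
  · have h2 : 1 ≤ t⁻¹ := (one_le_inv₀ ht).2 h1.le
    have hp : 0 < ⌊t⁻¹⌋₊ := Nat.floor_pos.2 h2
    have hp' : (1 : ℝ) ≤ ⌊t⁻¹⌋₊ := by exact_mod_cast hp
    refine ⟨Scale.inv ⟨⌊t⁻¹⌋₊, hp⟩,
      le_inv_of_le_inv₀ (Nat.cast_pos.2 hp) (Nat.floor_le (inv_pos.2 ht).le), ?_⟩
    change ((⌊t⁻¹⌋₊ : ℝ))⁻¹ ≤ _
    have h3 := Nat.lt_floor_add_one t⁻¹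
    refine inv_le_of_inv_le₀ (by linarith) ?_
    rw [mul_inv]
    linarith

theorem isControlled_of_lower_upper {D : Set X} {κ ω : Moduli} {φ : D → E}
    (h : ∀ a b : D, ∀ hab : a.1 ≠ b.1,
      κ.1 (lower (dist a.1 b.1) (dist_pos.2 hab)) ≤ edist (φ a) (φ b) ∧
      edist (φ a) (φ b) ≤ ω.1 (upper (dist a.1 b.1) (dist_pos.2 hab))) :
    IsControlled κ.1 ω.1 φ := by
  constructor
  · intro r a b hr
    have hab : a.1 ≠ b.1 := dist_pos.1 ((Scale.pos r).trans_le hr)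
    exact (κ.2 ((lower_spec _ (dist_pos.2 hab)).2 hr)).trans (h a b hab).1
  · intro r a b hr
    by_cases hab : a.1 = b.1
    · rw [Subtype.ext hab, edist_self]
      exact zero_le
    · exact (h a b hab).2.trans (ω.2 ((upper_spec _ (dist_pos.2 hab)).2 hr))

theorem compression_apply_ge {φ : X → E} {r : Scale} {t : ℝ≥0∞}
    (h : ∀ p q, (r : ℝ) ≤ dist p q → t ≤ edist (φ p) (φ q)) : t ≤ (compression φ).1 r := by
  refine le_sInf ?_
  rintro _ ⟨p, q, hpq, rfl⟩
  exact h p q hpq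

theorem expansion_apply_le {φ : X → E} {r : Scale} {t : ℝ≥0∞}
    (h : ∀ p q, dist p q ≤ (r : ℝ) → edist (φ p) (φ q) ≤ t) : (expansion φ).1 r ≤ t := by
  refine sSup_le ?_
  rintro _ ⟨p, q, hpq, rfl⟩
  exact h p q hpq

theorem coarselyEmbeds_of_isControlled {D : Set X} (hD : Dense D) {κ ω : Moduli} {φ : D → E}
    (hM : (κ, ω) ∈ MCoarse) (h : IsControlled κ.1 ω.1 φ) : CoarselyEmbeds X E := by
  have hnear : ∀ p : X, ∃ a : D, dist p a < 1 := fun p => by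
    obtain ⟨a, ha, hpa⟩ := hD.exists_dist_lt p one_pos
    exact ⟨⟨a, ha⟩, hpa⟩
  choose s hs using hnear
  refine ⟨φ ∘ s, fun r => ?_, ?_⟩
  -- Rounding both points to `D` changes their distance by less than 2.
  · obtain ⟨t, ht, -⟩ := Scale.exists_between (t := r + 2) (by linarith [Scale.pos r])
    refine (expansion_apply_le fun p q hpq => h.2 t (s p) (s q) ?_).trans_lt (hM.1 t)
    have := dist_triangle4 (s p : X) p q (s q)
    have := hs p
    have := hs q
    rw [dist_comm (s p : X) p] at *
    linarith
  · rw [ENNReal.tendsto_nhds_top_iff_nnreal]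
    intro b
    have h1 := (ENNReal.tendsto_nhds_top_iff_nnreal.1 hM.2 b)
    obtain ⟨N, hN⟩ := eventually_atTop.1 h1
    filter_upwards [eventually_ge_atTop (N + 2)] with n hn
    refine (hN N le_rfl).trans_le (compression_apply_ge fun p q hpq => h.1 _ (s p) (s q) ?_)
    have hn' : (N : ℝ) + 2 ≤ n := by exact_mod_cast hn
    rw [Scale.coe_nat] at *
    have := dist_triangle4 p (s p : X) (s q) q
    have := hs p
    have := hs q
    rw [dist_comm (s q : X) q] at *
    linarith

theorem IsControlled.uniformContinuous {D : Set X} {κ ω : Scale → ℝ≥0∞} {φ : D → E}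
    (h : IsControlled κ ω φ) (hω : Tendsto (fun n : ℕ+ => ω (Scale.inv n)) atTop (𝓝 0)) :
    UniformContinuous φ := by
  rw [EMetric.uniformContinuous_iff]
  intro ε hε
  obtain ⟨n, hn⟩ := (hω.eventually_lt_const hε).exists
  refine ⟨ENNReal.ofReal (Scale.inv n), ENNReal.ofReal_pos.2 (Scale.pos _), fun {a b} hab => ?_⟩
  rw [edist_lt_ofReal] at hab
  exact (h.2 _ a b (le_of_lt hab)).trans_lt hn

variable [CompleteSpace E]

/-- Points of `D` close to `p` and `q` have their distance in the open set `S`; the limit of the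
image distances stays in the closed set `T`. Bounds thus survive only for strict inequalities of
distances, so the embedding results move to a neighbouring scale. -/
theorem edist_extend_mem {D : Set X} (hD : Dense D) {φ : D → E} (hφ : UniformContinuous φ)
    {S : Set ℝ} (hS : IsOpen S) {T : Set ℝ≥0∞} (hT : IsClosed T)
    (h : ∀ a b : D, dist a.1 b.1 ∈ S → edist (φ a) (φ b) ∈ T) {p q : X} (hpq : dist p q ∈ S) :
    edist (hD.extend φ p) (hD.extend φ q) ∈ T := by
  have hne : ∀ p : X, (comap ((↑) : D → X) (𝓝 p)).NeBot := hD.isDenseInducing_val.comap_nhds_neBot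
  have hp := hD.extend_spec hφ p
  have hq := hD.extend_spec hφ q
  have hlim := (hp.comp tendsto_fst).edist
    (hq.comp (tendsto_snd (f := comap ((↑) : D → X) (𝓝 p))))
  have hd : Tendsto (fun a : D × D => dist a.1.1 a.2.1)
      (comap (↑) (𝓝 p) ×ˢ comap (↑) (𝓝 q)) (𝓝 (dist p q)) :=
    (tendsto_comap.comp tendsto_fst).dist (tendsto_comap.comp tendsto_snd)
  refine hT.mem_of_tendsto hlim ?_
  filter_upwards [hd.eventually_mem (hS.mem_nhds hpq)] with a ha
  exact h _ _ ha

theorem IsControlled.le_edist_extend {D : Set X} (hD : Dense D) {κ ω : Scale → ℝ≥0∞} {φ : D → E}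
    (h : IsControlled κ ω φ) (hφ : UniformContinuous φ) (r : Scale) {p q : X}
    (hpq : (r : ℝ) < dist p q) : κ r ≤ edist (hD.extend φ p) (hD.extend φ q) :=
  edist_extend_mem hD hφ isOpen_Ioi isClosed_Ici (S := Set.Ioi (r : ℝ)) (T := Set.Ici (κ r))
    (fun a b hab => h.1 r a b (le_of_lt hab)) hpq

theorem IsControlled.edist_extend_le {D : Set X} (hD : Dense D) {κ ω : Scale → ℝ≥0∞} {φ : D → E}
    (h : IsControlled κ ω φ) (hφ : UniformContinuous φ) (r : Scale) {p q : X}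
    (hpq : dist p q < r) : edist (hD.extend φ p) (hD.extend φ q) ≤ ω r :=
  edist_extend_mem hD hφ isOpen_Iio isClosed_Iic (S := Set.Iio (r : ℝ)) (T := Set.Iic (ω r))
    (fun a b hab => h.2 r a b (le_of_lt hab)) hpq

theorem uniformlyEmbeds_of_isControlled {D : Set X} (hD : Dense D) {κ ω : Moduli} {φ : D → E}
    (hM : (κ, ω) ∈ MUniform) (h : IsControlled κ.1 ω.1 φ) : UniformlyEmbeds X E := by
  have hφ := h.uniformContinuous hM.2
  refine ⟨hD.extend φ, fun r => ?_, ?_⟩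
  · have hr := Scale.pos r
    -- This gives `s ≤ r / 2 < r`, the strict inequality needed for the extension.
    obtain ⟨s, -, hs⟩ := Scale.exists_between (t := (r : ℝ) / 4) (by linarith)
    exact (hM.1 s).trans_le
      (compression_apply_ge fun p q hpq => h.le_edist_extend hD hφ s (by linarith))
  · rw [ENNReal.tendsto_nhds_zero]
    intro ε hε
    obtain ⟨N, hN⟩ := (hM.2.eventually_lt_const hε).exists
    filter_upwards [eventually_gt_atTop N] with n hn
    refine (expansion_apply_le fun p q hpq => h.edist_extend_le hD hφ (Scale.inv N) ?_).trans hN.le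
    refine lt_of_le_of_lt hpq ?_
    rw [Scale.coe_inv, Scale.coe_inv]
    exact inv_strictAnti₀ (Nat.cast_pos.2 N.pos) (Nat.cast_lt.2 hn)

theorem biLipschitzEmbeds_of_isControlled {D : Set X} (hD : Dense D) {κ ω : Moduli} {φ : D → E}
    (hM : (κ, ω) ∈ MLipschitz) (h : IsControlled κ.1 ω.1 φ) : BiLipschitzEmbeds X E := by
  obtain ⟨c, C, hc, hcC, hcC'⟩ := hM
  have hω : Tendsto (fun n : ℕ+ => ω.1 (Scale.inv n)) atTop (𝓝 0) := by
    have h1 : Tendsto (fun n : ℕ+ => C * ((n : ℕ) : ℝ)⁻¹) atTop (𝓝 (C * 0)) :=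
      (tendsto_inv_atTop_nhds_zero_nat.comp tendsto_PNat_val_atTop_atTop).const_mul C
    have h2 := ENNReal.tendsto_ofReal h1
    rw [mul_zero, ENNReal.ofReal_zero] at h2
    exact tendsto_of_tendsto_of_tendsto_of_le_of_le tendsto_const_nhds h2
      (fun _ => zero_le) (fun n => (hcC' (Scale.inv n)).2)
  have hφ := h.uniformContinuous hω
  -- Below, a scale in `[r/4, r/2]` serves for the lower bound and one in `[2r, 4r]` for the upper
  -- bound.
  refine ⟨hD.extend φ, c / 4, 4 * C, by linarith, by linarith, fun r => ?_⟩
  have hr := Scale.pos r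
  constructor
  · obtain ⟨s, hs, hs'⟩ := Scale.exists_between (t := (r : ℝ) / 4) (by linarith)
    refine le_trans (ENNReal.ofReal_le_ofReal ?_) ((hcC' s).1.trans
      (compression_apply_ge fun p q hpq => h.le_edist_extend hD hφ s (by linarith)))
    have := mul_le_mul_of_nonneg_left hs hc.le
    linarith
  · obtain ⟨s, hs, hs'⟩ := Scale.exists_between (t := 2 * (r : ℝ)) (by linarith)
    refine le_trans ((expansion_apply_le fun p q hpq => h.edist_extend_le hD hφ s
      (by linarith)).trans (hcC' s).2) (ENNReal.ofReal_le_ofReal ?_)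
    have := mul_le_mul_of_nonneg_left hs' (hc.trans hcC).le
    linarith

end Extension

/-! ### The space of moduli and its Borel classes. -/

section Measurability

theorem isClosed_moduli : IsClosed Moduli := by
  have : Moduli = ⋂ (r : Scale) (s : Scale) (_ : r ≤ s), {κ | κ r ≤ κ s} := by
    ext κ
    simp [Moduli, Monotone]
  rw [this]
  exact isClosed_iInter fun r => isClosed_iInter fun s => isClosed_iInter fun _ =>
    isClosed_le (continuous_apply r) (continuous_apply s)

instance : Countable Scale := by
  have : Scale = (Set.range fun n : ℕ+ => (n : ℝ)) ∪ Set.range fun n : ℕ+ => (n : ℝ)⁻¹ := by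
    ext r
    simp only [Scale, Set.mem_ofPred_eq, Set.mem_union, Set.mem_range, exists_or, eq_comm]
  rw [this]
  exact ((Set.countable_range _).union (Set.countable_range _)).to_subtype

instance : PolishSpace Moduli := isClosed_moduli.polishSpace

theorem continuous_fst_apply (r : Scale) : Continuous fun p : Moduli × Moduli => p.1.1 r :=
  (continuous_apply r).comp (continuous_subtype_val.comp continuous_fst)

theorem continuous_snd_apply (r : Scale) : Continuous fun p : Moduli × Moduli => p.2.1 r :=
  (continuous_apply r).comp (continuous_subtype_val.comp continuous_snd)

variable {P : Type*} [TopologicalSpace P] [MeasurableSpace P] [BorelSpace P]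

theorem measurableSet_tendsto_top {F : ℕ+ → P → ℝ≥0∞} (hF : ∀ n, Continuous (F n)) :
    MeasurableSet {p | Tendsto (fun n => F n p) atTop (𝓝 ∞)} := by
  simp only [ENNReal.tendsto_nhds_top_iff_nat, eventually_atTop, Set.ofPred_forall,
    Set.ofPred_exists]
  exact .iInter fun m => .iUnion fun N => .iInter fun n => .iInter fun _ =>
    (isOpen_lt continuous_const (hF n)).measurableSet

variable [MeasurableSpace (Moduli × Moduli)] [BorelSpace (Moduli × Moduli)]

theorem measurableSet_MCoarse : MeasurableSet MCoarse := by
  have h : MeasurableSet {p : Moduli × Moduli | ∀ r : Scale, p.2.1 r < ∞} := by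
    rw [Set.ofPred_forall]
    exact .iInter fun r => (isOpen_lt (continuous_snd_apply r) continuous_const).measurableSet
  exact h.inter (measurableSet_tendsto_top fun n => continuous_fst_apply _)

theorem measurableSet_MUniform : MeasurableSet MUniform := by
  have h : MeasurableSet {p : Moduli × Moduli | ∀ r : Scale, 0 < p.1.1 r} := by
    rw [Set.ofPred_forall]
    exact .iInter fun r => (isOpen_lt continuous_const (continuous_fst_apply r)).measurableSet
  -- Convergence of `ω(1/n)` to 0 is convergence of its inverse to `∞`.
  have h' := measurableSet_tendsto_top fun n => (continuous_snd_apply (Scale.inv n)).inv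
  simp only [← ENNReal.inv_zero, Pi.inv_apply, tendsto_inv_iff] at h'
  exact h.inter h'

theorem measurableSet_MLipschitz : MeasurableSet MLipschitz := by
  -- Countably many constants suffice; `n + 1` rather than `n` keeps `c < C` when `n = 1`.
  have : MLipschitz = ⋃ n : ℕ+, ⋂ r : Scale,
      {p | ENNReal.ofReal ((n : ℝ)⁻¹ * r) ≤ p.1.1 r} ∩
        {p | p.2.1 r ≤ ENNReal.ofReal ((n + 1 : ℝ) * r)} := by
    ext p
    simp only [Set.mem_iUnion, Set.mem_iInter]
    constructor
    · rintro ⟨c, C, hc, hcC, h⟩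
      obtain ⟨n, hn⟩ := exists_nat_gt (max c⁻¹ C)
      obtain ⟨h1, h2⟩ := max_lt_iff.1 hn
      have hn0 : 0 < n := Nat.cast_pos.1 ((inv_pos.2 hc).trans h1)
      refine ⟨⟨n, hn0⟩, fun r => ⟨le_trans (ENNReal.ofReal_le_ofReal ?_) (h r).1,
        (h r).2.trans (ENNReal.ofReal_le_ofReal ?_)⟩⟩
      · exact mul_le_mul_of_nonneg_right (inv_le_of_inv_le₀ hc h1.le) (Scale.pos r).le
      · refine mul_le_mul_of_nonneg_right ?_ (Scale.pos r).le
        change C ≤ (n : ℝ) + 1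
        linarith
    · rintro ⟨n, h⟩
      have hn : (1 : ℝ) ≤ n := by exact_mod_cast n.pos
      have := inv_le_one_of_one_le₀ hn
      exact ⟨(n : ℝ)⁻¹, n + 1, inv_pos.2 (by linarith), by linarith, h⟩
  rw [this]
  exact .iUnion fun n => .iInter fun r => .inter
    (isClosed_le continuous_const (continuous_fst_apply r)).measurableSet
    (isClosed_le (continuous_snd_apply r) continuous_const).measurableSet

end Measurability

/-! ### Topological complexity of the relation. -/

section Quadruples

variable {X E : Type*} [MetricSpace E]

theorem isClosed_omega [MetricSpace X] (x : ℕ+ → X) : IsClosed (Omega x E) := by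
  -- As `k` is discrete, every condition on it is open, so it may be the premise of a closed
  -- implication.
  have hk : ∀ S : Set ℕ+, IsOpen {q : Quad x E | q.2.2.1 ∈ S} := fun S =>
    (isOpen_discrete S).preimage (by fun_prop)
  change IsClosed {q : Quad x E | ∀ a b : Set.range x,
    a.1 ∈ x '' Set.Iic q.2.2.1 → b.1 ∈ x '' Set.Iic q.2.2.1 → ∀ h : a.1 ≠ b.1,
      q.1.1 (lower (dist a.1 b.1) (dist_pos.2 h)) ≤ edist (q.2.2.2 a) (q.2.2.2 b) ∧
      edist (q.2.2.2 a) (q.2.2.2 b) ≤ q.2.1.1 (upper (dist a.1 b.1) (dist_pos.2 h))}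
  rw [Set.ofPred_forall]
  refine isClosed_iInter fun a => ?_
  rw [Set.ofPred_forall]
  refine isClosed_iInter fun b => ?_
  refine isClosed_imp (hk {k | a.1 ∈ x '' Set.Iic k}) ?_
  refine isClosed_imp (hk {k | b.1 ∈ x '' Set.Iic k}) ?_
  rw [Set.ofPred_forall]
  refine isClosed_iInter fun h => ?_
  have hφ : Continuous fun q : Quad x E => edist (q.2.2.2 a) (q.2.2.2 b) := by fun_prop
  have hκ : ∀ r, Continuous fun q : Quad x E => q.1.1 r := fun r =>
    (continuous_apply r).comp (continuous_subtype_val.comp continuous_fst)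
  have hω : ∀ r, Continuous fun q : Quad x E => q.2.1.1 r := fun r =>
    (continuous_apply r).comp (continuous_subtype_val.comp (continuous_fst.comp continuous_snd))
  exact (isClosed_le (hκ _) hφ).inter (isClosed_le hφ (hω _))

theorem isClosed_below (x : ℕ+ → X) : IsClosed {p : Quad x E × Quad x E | Below p.1 p.2} := by
  have h1 : IsClosed {p : Quad x E × Quad x E | (p.1.1, p.1.2.1) = (p.2.1, p.2.2.1)} :=
    isClosed_eq (by fun_prop) (by fun_prop)
  have hk : ∀ S : Set (ℕ+ × ℕ+), IsClopen {p : Quad x E × Quad x E |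
      (p.1.2.2.1, p.2.2.2.1) ∈ S} := fun S => (isClopen_discrete S).preimage (by fun_prop)
  refine h1.inter ((hk {k | k.1 = k.2 + 1}).isClosed.inter ?_)
  change IsClosed {p : Quad x E × Quad x E | ∀ a : Set.range x,
    a.1 ∈ x '' Set.Iic p.2.2.2.1 → p.1.2.2.2 a = p.2.2.2.2 a}
  rw [Set.ofPred_forall]
  exact isClosed_iInter fun a => isClosed_imp (hk {k | a.1 ∈ x '' Set.Iic k.2}).isOpen
    (isClosed_eq (by fun_prop) (by fun_prop))

theorem analyticSet_belowOn [MetricSpace X] (x : ℕ+ → X) [CompleteSpace E] [SeparableSpace E]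
    [MeasurableSpace (Moduli × Moduli)] [BorelSpace (Moduli × Moduli)]
    {M : Set (Moduli × Moduli)} (hM : MeasurableSet M) :
    MeasureTheory.AnalyticSet {p : Quad x E × Quad x E |
      ∃ a b : OmegaIn M x E, BelowOn (OmegaIn M x E) a b ∧ (a.1, b.1) = p} := by
  have : SecondCountableTopology E := UniformSpace.secondCountable_of_separable E
  have : Countable (Set.range x) := (Set.countable_range x).to_subtype
  have : PolishSpace ℕ+ := inferInstance
  have : PolishSpace (Quad x E) := inferInstance
  have : PolishSpace (Quad x E × Quad x E) := inferInstance
  borelize (Quad x E × Quad x E)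
  have hA : ∀ g : Quad x E × Quad x E → Quad x E, Continuous g →
      MeasurableSet (g ⁻¹' OmegaIn M x E) := fun g hg => by
    have hm : Measurable fun p => ((g p).1, (g p).2.1) := Continuous.measurable (by fun_prop)
    exact ((isClosed_omega x).preimage hg).measurableSet.inter (hm hM)
  have heq : {p : Quad x E × Quad x E |
      ∃ a b : OmegaIn M x E, BelowOn (OmegaIn M x E) a b ∧ (a.1, b.1) = p} =
      (Prod.fst ⁻¹' OmegaIn M x E ∩ Prod.snd ⁻¹' OmegaIn M x E) ∩ {p | Below p.1 p.2} := by
    ext p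
    constructor
    · rintro ⟨a, b, h, rfl⟩
      exact ⟨⟨a.2, b.2⟩, h⟩
    · rintro ⟨⟨ha, hb⟩, h⟩
      exact ⟨⟨p.1, ha⟩, ⟨p.2, hb⟩, h, rfl⟩
  rw [heq]
  exact (((hA _ continuous_fst).inter (hA _ continuous_snd)).inter
    (isClosed_below x).measurableSet).analyticSet

end Quadruples

/-! ### Descending chains against countable rank. -/

section Dichotomy

variable {X E : Type*} [MetricSpace X] [MetricSpace E]

theorem exists_isControlled_of_not_wellFounded {x : ℕ+ → X} {M : Set (Moduli × Moduli)}
    (h : ¬ WellFounded (BelowOn (OmegaIn M x E))) :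
    ∃ (κ ω : Moduli) (φ : Set.range x → E), (κ, ω) ∈ M ∧ IsControlled κ.1 ω.1 φ := by
  rw [wellFounded_iff_isEmpty_descending_chain, not_isEmpty_iff] at h
  obtain ⟨q, hq⟩ := h
  have hmod : ∀ n, ((q n).1.1, (q n).1.2.1) = ((q 0).1.1, (q 0).1.2.1) := by
    intro n
    induction n with
    | zero => rfl
    | succ n ih => exact (hq n).1.trans ih
  -- Hence the `n`-th map is controlled at `x i` for all `i ≤ n`, and its value there is final.
  have hk : ∀ n, n < ((q n).1.2.2.1 : ℕ) := by
    intro n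
    induction n with
    | zero => exact PNat.pos _
    | succ n ih =>
      rw [show (q (n + 1)).1.2.2.1 = (q n).1.2.2.1 + 1 from (hq n).2.1, PNat.add_coe,
        PNat.one_coe]
      omega
  have hmem : ∀ (i : ℕ+) (n : ℕ), (i : ℕ) ≤ n → x i ∈ x '' Set.Iic (q n).1.2.2.1 :=
    fun i n hi => ⟨i, PNat.coe_le_coe _ _ |>.1 (hi.trans (hk n).le), rfl⟩
  choose idx hidx using fun a : Set.range x => a.2
  have hstab : ∀ a n, (idx a : ℕ) ≤ n → (q n).1.2.2.2 a = (q (idx a)).1.2.2.2 a := by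
    intro a n hn
    induction n, hn using Nat.le_induction with
    | base => rfl
    | succ n hn ih =>
      rw [← ih]
      exact (hq n).2.2 a (hidx a ▸ hmem _ n hn)
  refine ⟨(q 0).1.1, (q 0).1.2.1, fun a => (q (idx a)).1.2.2.2 a, (q 0).2.2,
    isControlled_of_lower_upper fun a b hab => ?_⟩
  obtain ⟨m, hm, hm'⟩ : ∃ m : ℕ, (idx a : ℕ) ≤ m ∧ (idx b : ℕ) ≤ m :=
    ⟨_, le_max_left _ _, le_max_right _ _⟩
  have hΩ := (q m).2.1 a b (hidx a ▸ hmem _ m hm) (hidx b ▸ hmem _ m hm') hab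
  obtain ⟨h1, h2⟩ := Prod.mk.inj (hmod m)
  rwa [hstab a m hm, hstab b m hm', h1, h2] at hΩ

theorem embeds_or_hasCountableRank [CompleteSpace E] [SeparableSpace E] (x : ℕ+ → X)
    [MeasurableSpace (Moduli × Moduli)] [BorelSpace (Moduli × Moduli)]
    {M : Set (Moduli × Moduli)} (hM : MeasurableSet M)
    (hemb : ∀ (κ ω : Moduli) (φ : Set.range x → E), (κ, ω) ∈ M → IsControlled κ.1 ω.1 φ →
      Embeds M X E) :
    Embeds M X E ∨ HasCountableRank (BelowOn (OmegaIn M x E)) := by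
  by_cases hwf : WellFounded (BelowOn (OmegaIn M x E))
  · exact Or.inr (hasCountableRank_of_analyticSet hwf (analyticSet_belowOn x hM))
  · obtain ⟨κ, ω, φ, hκω, hφ⟩ := exists_isControlled_of_not_wellFounded hwf
    exact Or.inl (hemb κ ω φ hκω hφ)

end Dichotomy

end EmbRank

theorem mainTheorem4 {X E : Type*} [MetricSpace X] [CompleteSpace X] [SeparableSpace X]
    [MetricSpace E] [CompleteSpace E] [SeparableSpace E]
    (x : ℕ+ → X) (hx : DenseRange x) :
    (EmbRank.CoarselyEmbeds X E ∨
      EmbRank.HasCountableRank (EmbRank.BelowOn (EmbRank.Coa x E))) ∧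
    (EmbRank.UniformlyEmbeds X E ∨
      EmbRank.HasCountableRank (EmbRank.BelowOn (EmbRank.Uni x E))) ∧
    (EmbRank.BiLipschitzEmbeds X E ∨
      EmbRank.HasCountableRank (EmbRank.BelowOn (EmbRank.Lip x E))) := by
  borelize (EmbRank.Moduli × EmbRank.Moduli)
  exact ⟨EmbRank.embeds_or_hasCountableRank x EmbRank.measurableSet_MCoarse fun _ _ _ =>
      EmbRank.coarselyEmbeds_of_isControlled hx,
    EmbRank.embeds_or_hasCountableRank x EmbRank.measurableSet_MUniform fun _ _ _ =>
      EmbRank.uniformlyEmbeds_of_isControlled hx,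
    EmbRank.embeds_or_hasCountableRank x EmbRank.measurableSet_MLipschitz fun _ _ _ =>
      EmbRank.biLipschitzEmbeds_of_isControlled hx⟩
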